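/- Let $n$ be a positive integer and let $A\in \operatorname{M}_n(\mathbb Z)$ be non-singular, with characteristic polynomial $h_A\in\mathbb Z[x]$. Let $$G_A=\left\{A^{k}\mathbf x \;\middle|\; \mathbf x\in\mathbb Z^n,\ k\in\mathbb Z\right\},$$ a subgroup of $\mathbb Q^n$. For a prime $p$, let $t_p$ denote the multiplicity of $0$ as a root of the reduction of $h_A$ modulo $p$. Assume that (i) $h_A$ is irreducible in $\mathbb Z[x]$; (ii) there is a prime $p$ dividing $\det A$ with $h_A\not\equiv x^n \pmod p$; (iii) there is a prime $p$ such that $n$ and $t_p$ are coprime. Then the ring $\operatorname{End}(G_A)$ of all group endomorphisms of $G_A$ is commutative, and the group $\operatorname{Aut}(G_A)$ of all group automorphisms of $G_A$ is a finitely generated abelian group. -/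

import Mathlib

namespace ToroidalGroup

open Matrix Polynomial

/-- The matrix `A`, regarded as a matrix with rational entries. -/
def ratMatrix {n : ℕ} (A : Matrix (Fin n) (Fin n) ℤ) : Matrix (Fin n) (Fin n) ℚ :=
  A.map (Int.cast : ℤ → ℚ)

/-- The integer vector `x`, regarded as a vector with rational entries. -/
def ratVec {n : ℕ} (x : Fin n → ℤ) : Fin n → ℚ := fun i => (x i : ℚ)

theorem isUnit_det_ratMatrix {n : ℕ} (A : Matrix (Fin n) (Fin n) ℤ) (hA : A.det ≠ 0) :
    IsUnit (ratMatrix A).det := by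
  have h : (ratMatrix A).det = (A.det : ℚ) := (Int.cast_det A).symm
  rw [h]
  exact isUnit_iff_ne_zero.mpr (Int.cast_ne_zero.mpr hA)

theorem ratMatrix_mulVec {n : ℕ} (A : Matrix (Fin n) (Fin n) ℤ) (x : Fin n → ℤ) :
    ratMatrix A *ᵥ ratVec x = ratVec (A *ᵥ x) := by
  ext i
  simp [ratMatrix, ratVec, Matrix.mulVec, dotProduct]

theorem ratMatrix_pow_mulVec {n : ℕ} (A : Matrix (Fin n) (Fin n) ℤ) (x : Fin n → ℤ) (m : ℕ) :
    ratMatrix A ^ m *ᵥ ratVec x = ratVec (A ^ m *ᵥ x) := by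
  induction m with
  | zero => simp
  | succ m ih =>
    rw [pow_succ', ← Matrix.mulVec_mulVec, ih, ratMatrix_mulVec, pow_succ', Matrix.mulVec_mulVec]

/-- Lowering the exponent: `A ^ k x` is also of the form `A ^ l y` for every `l ≤ k`. -/
theorem exists_zpow_mulVec_of_le {n : ℕ} (A : Matrix (Fin n) (Fin n) ℤ) (hA : A.det ≠ 0)
    (x : Fin n → ℤ) {k l : ℤ} (hl : l ≤ k) :
    ∃ y : Fin n → ℤ, ratMatrix A ^ k *ᵥ ratVec x = ratMatrix A ^ l *ᵥ ratVec y := by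
  obtain ⟨m, rfl⟩ := Int.le.dest hl
  refine ⟨A ^ m *ᵥ x, ?_⟩
  rw [Matrix.zpow_add (isUnit_det_ratMatrix A hA), zpow_natCast, ← Matrix.mulVec_mulVec,
    ratMatrix_pow_mulVec]

/-- For a non-singular integer matrix `A`, the subgroup
`G_A = {A ^ k x | x ∈ ℤ ^ n, k ∈ ℤ}` of `ℚ ^ n`. -/
def groupG {n : ℕ} (A : Matrix (Fin n) (Fin n) ℤ) (hA : A.det ≠ 0) :
    AddSubgroup (Fin n → ℚ) where
  carrier := {v | ∃ (k : ℤ) (x : Fin n → ℤ), v = ratMatrix A ^ k *ᵥ ratVec x}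
  zero_mem' := ⟨0, 0, by ext i; simp [ratVec]⟩
  add_mem' := by
    rintro _ _ ⟨k, x, rfl⟩ ⟨l, y, rfl⟩
    obtain ⟨x', hx'⟩ := exists_zpow_mulVec_of_le A hA x (min_le_left k l)
    obtain ⟨y', hy'⟩ := exists_zpow_mulVec_of_le A hA y (min_le_right k l)
    refine ⟨min k l, x' + y', ?_⟩
    rw [hx', hy', ← Matrix.mulVec_add]
    have h : ratVec (x' + y') = ratVec x' + ratVec y' := by
      ext i
      simp [ratVec]
    rw [h]
  neg_mem' := by
    rintro _ ⟨k, x, rfl⟩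
    refine ⟨k, -x, ?_⟩
    have h : ratVec (-x) = -ratVec x := by
      ext i
      simp [ratVec]
    rw [h, Matrix.mulVec_neg]

/-- The reduction modulo `p` of the characteristic polynomial of `A`. -/
noncomputable def charpolyMod {n : ℕ} (A : Matrix (Fin n) (Fin n) ℤ) (p : ℕ) : (ZMod p)[X] :=
  A.charpoly.map (Int.castRingHom (ZMod p))

/-- `t_p`: the multiplicity of zero as a root of the characteristic polynomial modulo `p`. -/
noncomputable def zeroMult {n : ℕ} (A : Matrix (Fin n) (Fin n) ℤ) (p : ℕ) : ℕ :=
  (charpolyMod A p).rootMultiplicity 0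

/-- The primes `p` dividing `det A` such that the characteristic polynomial of `A`
is not congruent to `X ^ n` modulo `p`. -/
def primesP' {n : ℕ} (A : Matrix (Fin n) (Fin n) ℤ) : Set ℕ :=
  {p | p.Prime ∧ (p : ℤ) ∣ A.det ∧ charpolyMod A p ≠ X ^ n}

end ToroidalGroup

/-! Put V = ℚ^n, G = `groupG A hA`, and let E be the algebra of quasi-endomorphisms of G, that is,
of linear maps some nonzero multiple of which preserves G. Endomorphisms of G extend to V and land
in E, so commutativity of E is enough. Since A lies in E and h_A is irreducible, every nonzero
vector is cyclic for A. Hence V is a simple E-module, and its commutant F lies in ℚ[A], so F is a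
field. Let r = dim_F V, which divides n. By density E is all of End_F(V), and its matrix units make
G quasi-isomorphic to a power M^r (`exists_nsmulIndex_eq_pow`). Therefore [G : pG] = [M : pM]^r.
Fitting's decomposition modulo p gives [G : pG] = p^(n - t_p) (`nsmulIndex_groupG`), so r divides
both n and n - t_p. Coprimality forces r = 1, and E acts on a line over F. For automorphisms,
commuting with A places them in K = ℚ[x]/(h_A). Each becomes integral after multiplication by a
power of the root of h_A, so they are S-units for the finite set S of primes dividing that root, and
Dirichlet's theorem applies. -/

/-! ### The index [H : mH] and its invariance under quasi-isomorphism. -/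

namespace AddSubgroup

variable {M N : Type*} [AddCommGroup M] [AddCommGroup N]

/-- The index of `m H` in `H`. -/
noncomputable def nsmulIndex (H : AddSubgroup M) (m : ℕ) : ℕ :=
  (H.map (nsmulAddMonoidHom (α := M) m)).relIndex H

theorem map_nsmul_le (H : AddSubgroup M) (m : ℕ) : H.map (nsmulAddMonoidHom (α := M) m) ≤ H := by
  rintro _ ⟨x, hx, rfl⟩
  exact H.nsmul_mem hx m

theorem map_nsmul_map (H : AddSubgroup M) (f : M →+ N) (m : ℕ) :
    (H.map f).map (nsmulAddMonoidHom m) = (H.map (nsmulAddMonoidHom m)).map f := by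
  rw [map_map, map_map]
  congr 1
  ext x
  simp

theorem nsmulIndex_map (H : AddSubgroup M) {f : M →+ N} (hf : Function.Injective f) (m : ℕ) :
    (H.map f).nsmulIndex m = H.nsmulIndex m := by
  rw [nsmulIndex, map_nsmul_map, relIndex_map_map_of_injective _ _ hf, nsmulIndex]

theorem nsmulIndex_eq_index_range (H : AddSubgroup M) (m : ℕ) :
    H.nsmulIndex m = (nsmulAddMonoidHom (α := H) m).range.index := by
  simpa only [nsmulIndex, relIndex] using
    congrArg AddSubgroup.index (addSubgroupOf_map_nsmulAddMonoidHom_eq_range ..)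

theorem index_range_nsmul_congr (e : M ≃+ N) (m : ℕ) :
    (nsmulAddMonoidHom (α := M) m).range.index = (nsmulAddMonoidHom (α := N) m).range.index := by
  rw [← index_map_equiv _ e]
  congr 1
  ext x
  constructor
  · rintro ⟨_, ⟨y, rfl⟩, rfl⟩
    exact ⟨e y, by simp⟩
  · rintro ⟨y, rfl⟩
    exact ⟨m • e.symm y, ⟨e.symm y, rfl⟩, by simp⟩

theorem index_range_nsmul_pi (ι : Type*) [Fintype ι] (m : ℕ) :
    (nsmulAddMonoidHom (α := ι → M) m).range.index =
      (nsmulAddMonoidHom (α := M) m).range.index ^ Fintype.card ι := by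
  have h : (nsmulAddMonoidHom (α := ι → M) m).range =
      AddSubgroup.pi Set.univ fun _ => (nsmulAddMonoidHom (α := M) m).range := by
    ext x
    simp only [AddMonoidHom.mem_range, nsmulAddMonoidHom_apply, mem_pi, Set.mem_univ,
      forall_const]
    constructor
    · rintro ⟨y, rfl⟩ i
      exact ⟨y i, rfl⟩
    · intro h
      choose y hy using h
      exact ⟨y, funext hy⟩
  rw [h, index_pi, Finset.prod_const, Finset.card_univ]

theorem nsmulIndex_mul [IsAddTorsionFree M] (H : AddSubgroup M) {a b : ℕ} (hb : b ≠ 0) :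
    H.nsmulIndex (a * b) = H.nsmulIndex a * H.nsmulIndex b := by
  have hinj : Function.Injective (nsmulAddMonoidHom (α := M) b) := nsmul_right_injective hb
  have h : H.map (nsmulAddMonoidHom (α := M) (a * b)) =
      (H.map (nsmulAddMonoidHom a)).map (nsmulAddMonoidHom b) := by
    rw [map_map]
    congr 1
    ext x
    simp [mul_comm a b, mul_nsmul']
  rw [nsmulIndex, h, ← relIndex_mul_relIndex _ _ _ (map_mono (map_nsmul_le H a))
    (map_nsmul_le H b), relIndex_map_map_of_injective _ _ hinj]
  rfl

theorem nsmulIndex_ne_zero [IsAddTorsionFree M] (H : AddSubgroup M)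
    (h : ∀ p : ℕ, p.Prime → H.nsmulIndex p ≠ 0) {m : ℕ} (hm : m ≠ 0) : H.nsmulIndex m ≠ 0 := by
  induction m using induction_on_primes with
  | zero => exact absurd rfl hm
  | one =>
    have : H.map (nsmulAddMonoidHom (α := M) 1) = H := by
      ext x
      simp
    simp [nsmulIndex, this]
  | prime_mul p a hp ih =>
    have ha : a ≠ 0 := right_ne_zero_of_mul hm
    rw [nsmulIndex_mul _ ha]
    exact mul_ne_zero (h p hp) (ih ha)

/-- Compute [G : mH] through H and through mG. Multiplication by m is injective, so [mG : mH] = [G :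
H], and this finite factor cancels. -/
theorem nsmulIndex_eq_of_relIndex_ne_zero [IsAddTorsionFree M] {H G : AddSubgroup M} (hHG : H ≤ G)
    (h : H.relIndex G ≠ 0) {m : ℕ} (hm : m ≠ 0) : H.nsmulIndex m = G.nsmulIndex m := by
  have hinj : Function.Injective (nsmulAddMonoidHom (α := M) m) := nsmul_right_injective hm
  have h1 := relIndex_mul_relIndex _ _ _ (map_nsmul_le H m) hHG
  have h2 := relIndex_mul_relIndex _ _ _ (map_mono (f := nsmulAddMonoidHom m) hHG)
    (map_nsmul_le G m)
  rw [relIndex_map_map_of_injective _ _ hinj, ← h1, mul_comm] at h2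
  exact (Nat.eq_of_mul_eq_mul_right (Nat.pos_of_ne_zero h) h2).symm

/-- Quasi-isomorphic torsion-free groups `G`, `H` satisfy `[G : mG] = [H : mH]`. -/
theorem nsmulIndex_eq_of_quasi [IsAddTorsionFree M] {G H : AddSubgroup M}
    (hG : ∀ p : ℕ, p.Prime → G.nsmulIndex p ≠ 0) {a b : ℕ} (ha : a ≠ 0) (hb : b ≠ 0)
    (hGH : ∀ x ∈ G, a • x ∈ H) (hHG : ∀ x ∈ H, b • x ∈ G) {m : ℕ} (hm : m ≠ 0) :
    H.nsmulIndex m = G.nsmulIndex m := by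
  have hinj : Function.Injective (nsmulAddMonoidHom (α := M) b) := nsmul_right_injective hb
  rw [← nsmulIndex_map H hinj]
  have hle : H.map (nsmulAddMonoidHom (α := M) b) ≤ G := by
    rintro _ ⟨x, hx, rfl⟩
    exact hHG x hx
  refine nsmulIndex_eq_of_relIndex_ne_zero hle ?_ hm
  -- The chain abG ≤ bH ≤ G, with [G : abG] finite, shows that bH has finite index in G.
  have hle' : G.map (nsmulAddMonoidHom (α := M) (a * b)) ≤ H.map (nsmulAddMonoidHom b) := by
    rintro _ ⟨x, hx, rfl⟩
    exact ⟨a • x, hGH x hx, by simp [mul_comm a b, mul_nsmul']⟩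
  have h := relIndex_mul_relIndex _ _ _ hle' hle
  have h0 := nsmulIndex_ne_zero G hG (mul_ne_zero ha hb)
  rw [nsmulIndex, ← h] at h0
  exact right_ne_zero_of_mul h0

theorem nsmulIndex_pi (ι : Type*) [Fintype ι] (H : AddSubgroup M) (m : ℕ) :
    (AddSubgroup.pi (Set.univ : Set ι) fun _ => H).nsmulIndex m =
      H.nsmulIndex m ^ Fintype.card ι := by
  rw [nsmulIndex_eq_index_range, nsmulIndex_eq_index_range, ← index_range_nsmul_pi]
  refine index_range_nsmul_congr
    { toFun := fun x i => ⟨x.1 i, x.2 i (Set.mem_univ i)⟩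
      invFun := fun x => ⟨fun i => x i, fun i _ => (x i).2⟩
      left_inv := fun _ => rfl
      right_inv := fun _ => rfl
      map_add' := fun _ _ => rfl } m

end AddSubgroup

/-! ### The index of pG_A in G_A. -/

namespace ToroidalGroup

open Matrix Polynomial

variable {n : ℕ} (A : Matrix (Fin n) (Fin n) ℤ) (hA : A.det ≠ 0)

theorem ratVec_injective : Function.Injective (ratVec (n := n)) := fun _ _ h =>
  funext fun i => Int.cast_injective (α := ℚ) (congrFun h i)

/-- `ratVec` as an additive homomorphism. -/
def ratVecHom (n : ℕ) : (Fin n → ℤ) →+ (Fin n → ℚ) where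
  toFun := ratVec
  map_zero' := by ext; simp [ratVec]
  map_add' x y := by ext; simp [ratVec]

@[simp]
theorem ratVecHom_apply (x : Fin n → ℤ) : ratVecHom n x = ratVec x := rfl

theorem ratMatrix_pow_mulVec_injective (hA : A.det ≠ 0) (k : ℕ) :
    Function.Injective fun v : Fin n → ℚ => ratMatrix A ^ k *ᵥ v := by
  apply Matrix.mulVec_injective_of_isUnit
  exact ((Matrix.isUnit_iff_isUnit_det _).2 (isUnit_det_ratMatrix A hA)).pow k

theorem zpow_mulVec_mem {g : Fin n → ℚ} (hg : g ∈ groupG A hA) (k : ℤ) :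
    ratMatrix A ^ k *ᵥ g ∈ groupG A hA := by
  obtain ⟨j, x, rfl⟩ := hg
  exact ⟨k + j, x, by
    rw [Matrix.zpow_add (isUnit_det_ratMatrix A hA), Matrix.mulVec_mulVec]⟩

theorem mulVec_mem {g : Fin n → ℚ} (hg : g ∈ groupG A hA) :
    ratMatrix A *ᵥ g ∈ groupG A hA := by
  simpa using zpow_mulVec_mem A hA hg 1

theorem ratVec_mem (x : Fin n → ℤ) : ratVec x ∈ groupG A hA := ⟨0, x, by simp⟩

theorem zpow_neg_mul_pow (hA : A.det ≠ 0) (k : ℕ) :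
    ratMatrix A ^ (-(k : ℤ)) * ratMatrix A ^ k = 1 := by
  have h := isUnit_det_ratMatrix A hA
  rw [← zpow_natCast, ← Matrix.zpow_add h]
  simp

theorem mem_groupG_iff {g : Fin n → ℚ} :
    g ∈ groupG A hA ↔ ∃ (k : ℕ) (x : Fin n → ℤ), ratMatrix A ^ k *ᵥ g = ratVec x := by
  constructor
  · rintro ⟨j, x, rfl⟩
    obtain ⟨y, hy⟩ := exists_zpow_mulVec_of_le A hA x (neg_abs_le j)
    refine ⟨j.natAbs, y, ?_⟩
    rw [hy, Matrix.mulVec_mulVec, ← zpow_natCast, ← Matrix.zpow_add (isUnit_det_ratMatrix A hA)]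
    simp
  · rintro ⟨k, x, h⟩
    refine ⟨-k, x, ?_⟩
    rw [← h, Matrix.mulVec_mulVec, zpow_neg_mul_pow A hA, one_mulVec]

theorem exists_nsmul_eq_ratVec (v : Fin n → ℚ) :
    ∃ (m : ℕ) (x : Fin n → ℤ), m ≠ 0 ∧ m • v = ratVec x := by
  refine ⟨∏ i, (v i).den, fun i => (v i).num * ∏ j ∈ Finset.univ.erase i, ((v j).den : ℤ), ?_, ?_⟩
  · exact Finset.prod_ne_zero_iff.2 fun i _ => (v i).den_nz
  · ext i
    simp only [Pi.smul_apply, nsmul_eq_mul, ratVec]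
    rw [← Finset.mul_prod_erase _ _ (Finset.mem_univ i)]
    push_cast
    rw [mul_right_comm, Rat.den_mul_eq_num]

section Reduction

variable (p : ℕ)

/-- Coordinatewise reduction modulo `p`. -/
def redHom (n p : ℕ) : (Fin n → ℤ) →+ (Fin n → ZMod p) where
  toFun x i := (x i : ZMod p)
  map_zero' := by ext; simp
  map_add' x y := by ext; simp

theorem redHom_apply (x : Fin n → ℤ) (i : Fin n) : redHom n p x i = (x i : ZMod p) := rfl

theorem redHom_surjective : Function.Surjective (redHom n p) := fun y => by
  choose x hx using fun i => ZMod.intCast_surjective (y i)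
  exact ⟨x, funext hx⟩

theorem redHom_eq_zero_iff {x : Fin n → ℤ} : redHom n p x = 0 ↔ ∃ y, x = p • y := by
  constructor
  · intro h
    choose y hy using fun i => (ZMod.intCast_zmod_eq_zero_iff_dvd (x i) p).1 (congrFun h i)
    exact ⟨y, funext fun i => by simp [hy i]⟩
  · rintro ⟨y, rfl⟩
    ext i
    simp [redHom_apply]

/-- Multiplication by `A` modulo `p`. -/
noncomputable def modLin : Module.End (ZMod p) (Fin n → ZMod p) :=
  Matrix.mulVecLin (A.map (Int.castRingHom (ZMod p)))

theorem modLin_redHom (x : Fin n → ℤ) : modLin A p (redHom n p x) = redHom n p (A *ᵥ x) := by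
  ext i
  simp [modLin, redHom_apply, Matrix.mulVec, dotProduct]

theorem modLin_pow_redHom (k : ℕ) (x : Fin n → ℤ) :
    (modLin A p ^ k) (redHom n p x) = redHom n p (A ^ k *ᵥ x) := by
  induction k with
  | zero => simp
  | succ k ih =>
    rw [pow_succ', Module.End.mul_apply, ih, modLin_redHom, pow_succ', Matrix.mulVec_mulVec]

/-- Both sides say that A^k x lies in pℤ^n for some k; the factor A^k can be undone inside G_A. -/
theorem mem_maxGen_redHom_iff {x : Fin n → ℤ} :
    redHom n p x ∈ (modLin A p).maxGenEigenspace 0 ↔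
      ratVec x ∈ (groupG A hA).map (nsmulAddMonoidHom (α := Fin n → ℚ) p) := by
  simp only [Module.End.mem_maxGenEigenspace, zero_smul, sub_zero, modLin_pow_redHom,
    redHom_eq_zero_iff, AddSubgroup.mem_map, nsmulAddMonoidHom_apply]
  constructor
  · rintro ⟨k, y, h⟩
    have h' : ratMatrix A ^ k *ᵥ ratVec x = p • ratVec y := by
      rw [ratMatrix_pow_mulVec, h]
      exact map_nsmul (ratVecHom n) p y
    refine ⟨ratMatrix A ^ (-(k : ℤ)) *ᵥ ratVec y, ⟨_, y, rfl⟩, ?_⟩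
    rw [← Matrix.mulVec_smul, ← h', Matrix.mulVec_mulVec, zpow_neg_mul_pow A hA, one_mulVec]
  · rintro ⟨g, hg, h⟩
    obtain ⟨k, y, hy⟩ := (mem_groupG_iff A hA).1 hg
    refine ⟨k, y, ratVec_injective ?_⟩
    rw [← ratMatrix_pow_mulVec, ← h, Matrix.mulVec_smul, hy]
    exact (map_nsmul (ratVecHom n) p y).symm

variable [Fact p.Prime]

theorem groupG_eq_sup : groupG A hA =
    (ratVecHom n).range ⊔ (groupG A hA).map (nsmulAddMonoidHom (α := Fin n → ℚ) p) := by
  apply le_antisymm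
  · intro g hg
    obtain ⟨k, x, hx⟩ := (mem_groupG_iff A hA).1 hg
    -- Fitting's decomposition writes x ≡ z + A^k y modulo p with z killed by a power of A. Then x -
    -- A^k y lies in pG_A, and applying A^(-k) gives g ∈ y + pG_A.
    have hc := (modLin A p).isCompl_iSup_ker_pow_iInf_range_pow
    have hx' : redHom n p x ∈ (⨆ n, LinearMap.ker (modLin A p ^ n)) ⊔
        (⨅ n, LinearMap.range (modLin A p ^ n)) := by
      rw [hc.sup_eq_top]
      trivial
    obtain ⟨z, hz, y, hy, hzy⟩ := Submodule.mem_sup.1 hx'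
    obtain ⟨y, rfl⟩ := Submodule.mem_iInf _ |>.1 hy k
    obtain ⟨y, rfl⟩ := redHom_surjective p y
    rw [modLin_pow_redHom] at hzy
    have hz' : redHom n p (x - A ^ k *ᵥ y) ∈ (modLin A p).maxGenEigenspace 0 := by
      rw [← Module.End.iSup_genEigenspace_eq]
      simp only [Module.End.genEigenspace_nat, zero_smul, sub_zero]
      rw [map_sub, ← hzy, add_sub_cancel_right]
      exact hz
    obtain ⟨w, hw, hwx⟩ := (mem_maxGen_redHom_iff A hA p).1 hz'
    refine AddSubgroup.mem_sup.2 ⟨ratVec y, ⟨y, rfl⟩, p • (ratMatrix A ^ (-(k : ℤ)) *ᵥ w),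
      ⟨_, zpow_mulVec_mem A hA hw _, rfl⟩, ?_⟩
    rw [← Matrix.mulVec_smul]
    change p • w = ratVecHom n _ at hwx
    rw [hwx, map_sub, ratVecHom_apply, ratVecHom_apply, ← hx, ← ratMatrix_pow_mulVec,
      Matrix.mulVec_sub, Matrix.mulVec_mulVec, Matrix.mulVec_mulVec, zpow_neg_mul_pow A hA,
      one_mulVec, one_mulVec, add_sub_cancel]
  · refine sup_le ?_ (AddSubgroup.map_nsmul_le _ p)
    rintro _ ⟨x, rfl⟩
    exact ratVec_mem A hA x

theorem zeroMult_eq_finrank :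
    zeroMult A p = Module.finrank (ZMod p) ((modLin A p).maxGenEigenspace 0) := by
  rw [LinearMap.finrank_maxGenEigenspace_eq, modLin, Matrix.charpoly_mulVecLin,
    Matrix.charpoly_map]
  rfl

theorem zeroMult_le : zeroMult A p ≤ n := by
  rw [zeroMult_eq_finrank]
  simpa using Submodule.finrank_le ((modLin A p).maxGenEigenspace 0)

/-- The index of `p G_A` in `G_A` is `p ^ (n - t_p)`. -/
theorem nsmulIndex_groupG : (groupG A hA).nsmulIndex p = p ^ (n - zeroMult A p) := by
  -- As G_A = ℤ^n + pG_A, the index may be computed in ℤ^n, where pG_A cuts out the preimage of the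
  -- generalized 0-eigenspace modulo p.
  have h1 : ((groupG A hA).map (nsmulAddMonoidHom (α := Fin n → ℚ) p)).relIndex
      (groupG A hA) = ((groupG A hA).map (nsmulAddMonoidHom (α := Fin n → ℚ) p)).relIndex
      (ratVecHom n).range := by
    rw [← AddSubgroup.relIndex_sup_right (H := (ratVecHom n).range), ← groupG_eq_sup A hA p]
  have h2 : ((groupG A hA).map (nsmulAddMonoidHom (α := Fin n → ℚ) p)).comap (ratVecHom n) =
      ((modLin A p).maxGenEigenspace 0).toAddSubgroup.comap (redHom n p) := by
    ext x
    exact (mem_maxGen_redHom_iff A hA p).symm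
  rw [AddSubgroup.nsmulIndex, h1, ← AddSubgroup.index_comap, h2,
    AddSubgroup.index_comap_of_surjective _ (redHom_surjective p), AddSubgroup.index]
  change Nat.card ((Fin n → ZMod p) ⧸ (modLin A p).maxGenEigenspace 0) = _
  rw [Module.natCard_eq_pow_finrank (K := ZMod p), Nat.card_zmod, zeroMult_eq_finrank]
  congr 1
  have := Submodule.finrank_quotient_add_finrank ((modLin A p).maxGenEigenspace 0)
  rw [Module.finrank_fin_fun] at this
  omega

end Reduction

end ToroidalGroup

/-! ### Algebras containing an endomorphism with irreducible characteristic polynomial, and their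
commutants. -/

section EndomorphismAlgebra

open Polynomial Module

section Irreducible

variable {k V : Type*} [Field k] [AddCommGroup V] [Module k V] [FiniteDimensional k V]
  {a : Module.End k V}

/-- Otherwise a Bézout relation, evaluated at a and applied to v, gives v = 0 by Cayley–Hamilton. -/
theorem charpoly_dvd_of_aeval_apply_eq_zero (ha : Irreducible a.charpoly) {q : k[X]} {v : V}
    (hv : v ≠ 0) (h : aeval a q v = 0) : a.charpoly ∣ q := by
  by_contra hq
  obtain ⟨r, s, hrs⟩ := (ha.coprime_iff_not_dvd).2 hq
  apply hv
  have := congrArg (fun f => aeval a f v) hrs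
  simpa [h, LinearMap.aeval_self_charpoly, Module.End.mul_apply] using this.symm

/-- An endomorphism with irreducible characteristic polynomial has every nonzero vector as a
cyclic vector. -/
theorem exists_aeval_apply_eq (ha : Irreducible a.charpoly) {v : V} (hv : v ≠ 0) (w : V) :
    ∃ q : k[X], aeval a q v = w := by
  -- Evaluation at v of polynomials of degree below dim V: injective by the divisibility above,
  -- hence surjective by dimension.
  let f : degreeLT k (finrank k V) →ₗ[k] V :=
    ((LinearMap.applyₗ v).comp (aeval a).toLinearMap).comp (degreeLT k (finrank k V)).subtype
  have hf : Function.Injective f := by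
    rw [← LinearMap.ker_eq_bot, LinearMap.ker_eq_bot']
    rintro ⟨q, hq⟩ h0
    have hd := charpoly_dvd_of_aeval_apply_eq_zero ha hv (q := q) h0
    rw [Polynomial.mem_degreeLT] at hq
    refine Subtype.ext (Polynomial.eq_zero_of_dvd_of_degree_lt hd ?_)
    rwa [Polynomial.degree_eq_natDegree a.charpoly_monic.ne_zero, LinearMap.charpoly_natDegree]
  have hfr : finrank k (degreeLT k (finrank k V)) = finrank k V := by
    rw [(degreeLTEquiv k _).finrank_eq, finrank_fin_fun]
  have : FiniteDimensional k (degreeLT k (finrank k V)) :=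
    (degreeLTEquiv k (finrank k V)).symm.finiteDimensional
  obtain ⟨q, hq⟩ := (LinearMap.injective_iff_surjective_of_finrank_eq_finrank hfr).1 hf w
  exact ⟨q.1, hq⟩

/-- A map commuting with a is determined by its value at one cyclic vector. -/
theorem exists_eq_aeval_of_commute [Nontrivial V] (ha : Irreducible a.charpoly)
    {b : Module.End k V} (hb : Commute b a) : ∃ q : k[X], b = aeval a q := by
  obtain ⟨v, hv⟩ := exists_ne (0 : V)
  obtain ⟨q, hq⟩ := exists_aeval_apply_eq ha hv (b v)
  refine ⟨q, LinearMap.ext fun w => ?_⟩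
  obtain ⟨r, rfl⟩ := exists_aeval_apply_eq ha hv w
  have hbr : Commute b (aeval a r) := by
    rw [Polynomial.aeval_eq_sum_range]
    exact Commute.sum_right _ _ _ fun i _ => (hb.pow_right i).smul_right _
  have h1 : b (aeval a r v) = aeval a r (b v) := LinearMap.congr_fun hbr.eq v
  rw [h1, ← hq, ← Module.End.mul_apply, ← Module.End.mul_apply, ← map_mul, ← map_mul, mul_comm]

variable (E : Subalgebra k (Module.End k V))

theorem isSimpleModule_of_mem [Nontrivial V] (ha : Irreducible a.charpoly) (haE : a ∈ E) :
    IsSimpleModule E V := by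
  rw [isSimpleModule_iff_toSpanSingleton_surjective]
  refine ⟨inferInstance, fun v hv w => ?_⟩
  obtain ⟨q, hq⟩ := exists_aeval_apply_eq ha hv w
  exact ⟨⟨aeval a q, Algebra.adjoin_le (Set.singleton_subset_iff.2 haE)
    (aeval_mem_adjoin_singleton k a)⟩, hq⟩

/-- Elements of the commutant of `E` commute with each other. -/
theorem commutant_mul_comm [Nontrivial V] (ha : Irreducible a.charpoly) (haE : a ∈ E)
    (f g : Module.End E V) : f * g = g * f := by
  have h : ∀ f : Module.End E V, ∃ q : k[X], ∀ v, f v = aeval a q v := by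
    intro f
    let f' : Module.End k V :=
      { toFun := f
        map_add' := map_add f
        map_smul' := fun c v => f.map_smul (algebraMap k E c) v }
    obtain ⟨q, hq⟩ := exists_eq_aeval_of_commute ha (b := f') (LinearMap.ext fun v =>
      f.map_smul (⟨a, haE⟩ : E) v)
    exact ⟨q, fun v => LinearMap.congr_fun hq v⟩
  obtain ⟨q, hq⟩ := h f
  obtain ⟨r, hr⟩ := h g
  ext v
  rw [Module.End.mul_apply, Module.End.mul_apply, hr, hq, hq, hr, ← Module.End.mul_apply,
    ← Module.End.mul_apply, ← map_mul, ← map_mul, mul_comm]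

end Irreducible

section Commutant

variable {k V : Type*} [Field k] [AddCommGroup V] [Module k V]
  (E : Subalgebra k (Module.End k V))

instance commutant_finite [FiniteDimensional k V] : Module.Finite (Module.End E V) V :=
  Module.Finite.of_restrictScalars_finite k _ _

instance commutant_free [IsSimpleModule E V] : Module.Free (Module.End E V) V := by
  classical
  exact @Module.Free.of_divisionRing (Module.End E V) V inferInstance _ _

instance commutant_strongRankCondition [IsSimpleModule E V] :
    StrongRankCondition (Module.End E V) := by
  classical
  let D : DivisionRing (Module.End E V) := inferInstance
  exact @IsNoetherianRing.strongRankCondition _ _ D.toNontrivial inferInstance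

theorem finrank_commutant_dvd [FiniteDimensional k V] [IsSimpleModule E V] :
    finrank (Module.End E V) V ∣ finrank k V :=
  ⟨finrank k (Module.End E V), by rw [mul_comm, Module.finrank_mul_finrank]⟩

/-- The Jacobson density theorem: V is finite over its commutant, so E already gives every
commutant-linear map. -/
theorem exists_mem_of_commutant_linear [FiniteDimensional k V] [IsSimpleModule E V]
    (f : Module.End (Module.End E V) V) : ∃ T ∈ E, ∀ v, T v = f v := by
  obtain ⟨T, hT⟩ := Module.Finite.toModuleEnd_moduleEnd_surjective (R := E) (M := V) f
  exact ⟨T.1, T.2, fun v => LinearMap.congr_fun hT v⟩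

theorem mul_comm_of_finrank_commutant_eq_one [IsSimpleModule E V]
    (h1 : finrank (Module.End E V) V = 1)
    (hc : ∀ f g : Module.End E V, f * g = g * f) {S T : Module.End k V} (hS : S ∈ E)
    (hT : T ∈ E) : S * T = T * S := by
  -- With v spanning V over the commutant, S and T are determined by scalars s, t with Sv = sv and
  -- Tv = tv; these scalars commute.
  obtain ⟨v, hv, h⟩ := finrank_eq_one_iff'.1 h1
  obtain ⟨s, hs⟩ := h (S v)
  obtain ⟨t, ht⟩ := h (T v)
  have hcomm : ∀ (f : Module.End E V) {S : Module.End k V} (_ : S ∈ E) (w : V),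
      S (f • w) = f • S w := fun f S hS w => (f.map_smul (⟨S, hS⟩ : E) w).symm
  ext w
  obtain ⟨f, rfl⟩ := h w
  rw [Module.End.mul_apply, Module.End.mul_apply, hcomm f hT, hcomm f hS, hcomm f hS, hcomm f hT,
    ← ht, ← hs, hcomm t hS, hcomm s hT, ← hs, ← ht, ← mul_smul t s, ← mul_smul s t, hc]

end Commutant

/-! ### Quasi-endomorphisms and the commutativity criterion. -/

section Quasi

variable {V : Type*} [AddCommGroup V] [Module ℚ V]

/-- The algebra of quasi-endomorphisms of a subgroup of a rational vector space. -/
def quasiEnd (G : AddSubgroup V) : Subalgebra ℚ (Module.End ℚ V) where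
  carrier := {T | ∃ m : ℕ, m ≠ 0 ∧ ∀ g ∈ G, m • T g ∈ G}
  mul_mem' := by
    rintro S T ⟨a, ha, hS⟩ ⟨b, hb, hT⟩
    refine ⟨a * b, mul_ne_zero ha hb, fun g hg => ?_⟩
    rw [mul_smul, Module.End.mul_apply, ← map_nsmul S]
    exact hS _ (hT g hg)
  add_mem' := by
    rintro S T ⟨a, ha, hS⟩ ⟨b, hb, hT⟩
    refine ⟨a * b, mul_ne_zero ha hb, fun g hg => ?_⟩
    rw [LinearMap.add_apply, smul_add]
    refine G.add_mem ?_ ?_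
    · rw [mul_comm, mul_smul]
      exact G.nsmul_mem (hS g hg) b
    · rw [mul_smul]
      exact G.nsmul_mem (hT g hg) a
  algebraMap_mem' q := by
    refine ⟨q.den, q.den_nz, fun g hg => ?_⟩
    have : q.den • (algebraMap ℚ (Module.End ℚ V) q) g = q.num • g := by
      rw [Module.algebraMap_end_apply, ← Nat.cast_smul_eq_nsmul ℚ, smul_smul, Rat.den_mul_eq_num,
        Int.cast_smul_eq_zsmul]
    rw [this]
    exact G.zsmul_mem hg _

theorem mem_quasiEnd {G : AddSubgroup V} {T : Module.End ℚ V} (h : ∀ g ∈ G, T g ∈ G) :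
    T ∈ quasiEnd G := ⟨1, one_ne_zero, fun g hg => by simpa using h g hg⟩

theorem exists_uniform_nsmul_mem {ι : Type*} [Finite ι] {G : AddSubgroup V}
    {T : ι → Module.End ℚ V} (hT : ∀ i, T i ∈ quasiEnd G) :
    ∃ m : ℕ, m ≠ 0 ∧ ∀ i, ∀ g ∈ G, m • T i g ∈ G := by
  have := Fintype.ofFinite ι
  choose m hm h using hT
  refine ⟨∏ i, m i, Finset.prod_ne_zero_iff.2 fun i _ => hm i, fun i g hg => ?_⟩
  obtain ⟨c, hc⟩ := Finset.dvd_prod_of_mem m (Finset.mem_univ i)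
  rw [hc, mul_comm, mul_smul]
  exact G.nsmul_mem (h i g hg) c

/-- A group quasi-isomorphic to a power: `[G : pG]` is an `r`-th power, `r` being the dimension of
the ambient space over the commutant of the quasi-endomorphism algebra. -/
theorem exists_nsmulIndex_eq_pow [FiniteDimensional ℚ V] {G : AddSubgroup V}
    [IsSimpleModule (quasiEnd G) V] (hG : ∀ p : ℕ, p.Prime → G.nsmulIndex p ≠ 0) {m : ℕ}
    (hm : m ≠ 0) :
    ∃ c, G.nsmulIndex m = c ^ finrank (Module.End (quasiEnd G) V) V := by
  have : Nontrivial V := IsSimpleModule.nontrivial (quasiEnd G) V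
  have : IsAddTorsionFree V := .of_module_rat V
  set F := Module.End (quasiEnd G) V
  have hpos : 0 < finrank F V := by
    have := (finBasis F V).index_nonempty
    exact Fin.pos_iff_nonempty.2 this
  let b := finBasis F V
  let i₀ : Fin (finrank F V) := ⟨0, hpos⟩
  -- The matrix units for the basis `b` are commutant-linear, hence quasi-endomorphisms of G.
  have hT : ∀ ij : Fin (finrank F V) × Fin (finrank F V),
      ∃ T ∈ quasiEnd G, ∀ v, T v = b.coord ij.1 v • b ij.2 := fun ij =>
    exists_mem_of_commutant_linear (quasiEnd G) ((b.coord ij.1).smulRight (b ij.2))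
  choose T hTE hT using hT
  obtain ⟨a, ha, haT⟩ := exists_uniform_nsmul_mem hTE
  let M : AddSubgroup F := G.map (b.coord i₀).toAddMonoidHom
  let e : (Fin (finrank F V) → F) ≃+ V := b.equivFun.symm.toAddEquiv
  let P := AddSubgroup.pi (Set.univ : Set (Fin (finrank F V))) fun _ => M
  refine ⟨M.nsmulIndex m, ?_⟩
  have hP : (P.map e.toAddMonoidHom).nsmulIndex m = P.nsmulIndex m :=
    AddSubgroup.nsmulIndex_map P e.injective m
  rw [AddSubgroup.nsmulIndex_pi, Fintype.card_fin] at hP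
  rw [← hP]
  refine (AddSubgroup.nsmulIndex_eq_of_quasi hG ha ha ?_ ?_ hm).symm
  -- The i-th coordinate of ax is the i₀-th coordinate of aT(i, i₀)x, which lies in G; so aG is
  -- contained in the copy of M^r.
  · intro x hx
    refine ⟨e.symm (a • x), fun i _ => ⟨a • T (i, i₀) x, haT _ x hx, ?_⟩, e.apply_symm_apply _⟩
    change b.coord i₀ (a • T (i, i₀) x) = b.coord i (a • x)
    rw [hT, map_nsmul, map_nsmul, map_smul]
    simp
  · rintro _ ⟨y, hy, rfl⟩
    choose g hg hgy using fun i => hy i (Set.mem_univ i)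
    have he : a • e y = ∑ i, a • T (i₀, i) (g i) := by
      rw [← Finset.smul_sum]
      congr 1
      change b.equivFun.symm y = _
      rw [b.equivFun_symm_apply]
      refine Finset.sum_congr rfl fun i _ => ?_
      rw [hT, ← hgy i]
      rfl
    change a • e y ∈ G
    rw [he]
    exact G.sum_mem fun i _ => haT (i₀, i) _ (hg i)

/-- Commutativity criterion for the endomorphism ring of a torsion-free group of finite rank. -/
theorem mul_comm_of_coprime [FiniteDimensional ℚ V] [Nontrivial V] {G : AddSubgroup V}
    {a : Module.End ℚ V} (ha : Irreducible a.charpoly) (haG : ∀ g ∈ G, a g ∈ G)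
    (hG : ∀ p : ℕ, p.Prime → G.nsmulIndex p ≠ 0) {p s : ℕ} (hp : p.Prime)
    (hps : G.nsmulIndex p = p ^ s) (hs : Nat.Coprime (finrank ℚ V) s) {S T : Module.End ℚ V}
    (hS : ∀ g ∈ G, S g ∈ G) (hT : ∀ g ∈ G, T g ∈ G) : S * T = T * S := by
  have haE := mem_quasiEnd haG
  have := isSimpleModule_of_mem (quasiEnd G) ha haE
  obtain ⟨c, hc⟩ := exists_nsmulIndex_eq_pow hG hp.ne_zero
  have hr := finrank_commutant_dvd (quasiEnd G)
  refine mul_comm_of_finrank_commutant_eq_one (quasiEnd G) ?_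
    (commutant_mul_comm (quasiEnd G) ha haE) (mem_quasiEnd hS) (mem_quasiEnd hT)
  set r := finrank (Module.End (quasiEnd G) V) V
  have hr0 : r ≠ 0 := fun h => finrank_pos (R := ℚ) (M := V).ne' (Nat.eq_zero_of_zero_dvd (h ▸ hr))
  rw [hps] at hc
  -- From c^r = p^s it follows that c = p^j and s = jr, so r divides the coprime numbers dim V and
  -- s.
  obtain ⟨j, -, rfl⟩ := (Nat.dvd_prime_pow hp).1 (hc ▸ dvd_pow_self c hr0 : c ∣ p ^ s)
  rw [← pow_mul] at hc
  exact Nat.eq_one_of_dvd_coprimes hs hr ⟨j, by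
    rw [mul_comm]
    exact Nat.pow_right_injective hp.two_le hc⟩

end Quasi

end EndomorphismAlgebra

/-! ### Finite generation of S-units. -/

section SUnit

open IsDedekindDomain NumberField

theorem finite_valuation_ne_one {R : Type*} [CommRing R] [IsDedekindDomain R] (K : Type*) [Field K]
    [Algebra R K] [IsFractionRing R K] {r : R} (hr : r ≠ 0) :
    {v : HeightOneSpectrum R | v.valuation K (algebraMap R K r) ≠ 1}.Finite := by
  refine (Ideal.finite_factors (I := Ideal.span {r}) (by simpa using hr)).subset fun v hv => ?_
  rw [Set.mem_ofPred_eq] at hv ⊢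
  exact (v.valuation_lt_one_iff_dvd r).1 (lt_of_le_of_ne (v.valuation_le_one r) hv)

/-- Dirichlet's theorem for `S`-units: finite generation. -/
theorem sUnit_fg (K : Type*) [Field K] [NumberField K] {S : Set (HeightOneSpectrum (𝓞 K))}
    (hS : S.Finite) : Group.FG (S.unit K) := by
  have := hS.to_subtype
  -- `f` records the valuations at S. Its image lies in the Noetherian group ℤ^S, and its kernel in
  -- the image of the finitely generated group (𝓞 K)ˣ.
  let f : S.unit K →* (S → Multiplicative ℤ) :=
    (MonoidHom.pi fun v : S => v.1.valuationOfNeZero).comp (S.unit K).subtype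
  let g : (𝓞 K)ˣ →* S.unit K :=
    (Units.map (algebraMap (𝓞 K) K : 𝓞 K →* K)).codRestrict (S.unit K) fun u v _ => by
      rw [← HeightOneSpectrum.valuationOfNeZero_eq, HeightOneSpectrum.valuation_of_unit_eq]
      rfl
  have hfg : f.ker ≤ g.range := by
    intro x hx
    have hx1 : ∀ v : HeightOneSpectrum (𝓞 K), v.valuation K ((x : Kˣ) : K) = 1 := by
      intro v
      by_cases hv : v ∈ S
      · have h : v.valuationOfNeZero (x : Kˣ) = 1 := congrFun (MonoidHom.mem_ker.1 hx) ⟨v, hv⟩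
        rw [← HeightOneSpectrum.valuationOfNeZero_eq, h]
        rfl
      · exact x.2 v hv
    obtain ⟨a, ha⟩ := HeightOneSpectrum.mem_integers_of_valuation_le_one K _ fun v => (hx1 v).le
    obtain ⟨b, hb⟩ := HeightOneSpectrum.mem_integers_of_valuation_le_one (R := 𝓞 K) K
      ((x⁻¹ : S.unit K) : Kˣ).1 fun v => by
        rw [InvMemClass.coe_inv, Units.val_inv_eq_inv_val, map_inv₀, hx1 v, inv_one]
    have hab : a * b = 1 := by
      apply FaithfulSMul.algebraMap_injective (𝓞 K) K
      rw [map_mul, ha, hb, map_one]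
      simp
    refine ⟨⟨a, b, hab, by rw [mul_comm, hab]⟩, Subtype.ext (Units.ext ?_)⟩
    exact ha
  have hfin : Module.Finite ℤ (Additive (S.unit K)) := by
    rw [Module.finite_def]
    refine Submodule.fg_of_fg_map_of_fg_inf_ker (MonoidHom.toAdditive f).toIntLinearMap ?_ ?_
    · have : Module.Finite ℤ (Additive (S → Multiplicative ℤ)) :=
        inferInstanceAs (Module.Finite ℤ (S → ℤ))
      exact IsNoetherian.noetherian _
    · have hle : (⊤ : Submodule ℤ (Additive (S.unit K))) ⊓
          LinearMap.ker (MonoidHom.toAdditive f).toIntLinearMap ≤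
          LinearMap.range (MonoidHom.toAdditive g).toIntLinearMap := fun x hx => hfg hx.2
      have : Module.Finite ℤ (LinearMap.range (MonoidHom.toAdditive g).toIntLinearMap) :=
        inferInstance
      have hN : IsNoetherian ℤ (LinearMap.range (MonoidHom.toAdditive g).toIntLinearMap) :=
        isNoetherian_of_isNoetherianRing_of_finite ℤ _
      rw [isNoetherian_submodule] at hN
      exact hN _ hle
  rwa [GroupFG.iff_add_fg, ← Module.Finite.iff_addGroup_fg]

theorem fg_of_le_sUnit (K : Type*) [Field K] [NumberField K] {S : Set (HeightOneSpectrum (𝓞 K))}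
    (hS : S.Finite) {U : Subgroup Kˣ} (hU : U ≤ S.unit K) : Group.FG U := by
  have h := sUnit_fg K hS
  rw [GroupFG.iff_add_fg, ← Module.Finite.iff_addGroup_fg] at h ⊢
  exact Module.Finite.of_injective
    (MonoidHom.toAdditive (Subgroup.inclusion hU)).toIntLinearMap (Subgroup.inclusion_injective hU)

/-- A group of units which become integral after multiplication by powers of one fixed integral
element is finitely generated. -/
theorem fg_of_isIntegral_pow_mul {K : Type*} [Field K] [NumberField K] {r : K} (hr0 : r ≠ 0)
    (hr : IsIntegral ℤ r) {U : Subgroup Kˣ}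
    (hU : ∀ u ∈ U, ∃ k : ℕ, IsIntegral ℤ (r ^ k * (u : K))) : Group.FG U := by
  obtain ⟨s, rfl⟩ : ∃ s : 𝓞 K, algebraMap (𝓞 K) K s = r := ⟨⟨r, hr⟩, rfl⟩
  have hs : s ≠ 0 := by
    rintro rfl
    exact hr0 (map_zero _)
  refine fg_of_le_sUnit K (finite_valuation_ne_one K hs) fun u hu v hv => ?_
  have hv1 : v.valuation K (algebraMap (𝓞 K) K s) = 1 := not_not.1 hv
  -- Where `s` has valuation 1, integrality of s^k u bounds the valuation of u by 1; the same bound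
  -- for u⁻¹ gives equality.
  have key : ∀ u ∈ U, v.valuation K (u : K) ≤ 1 := by
    intro u hu
    obtain ⟨k, hk⟩ := hU u hu
    obtain ⟨t, ht⟩ : ∃ t : 𝓞 K, algebraMap (𝓞 K) K t = algebraMap (𝓞 K) K s ^ k * (u : K) :=
      ⟨⟨_, hk⟩, rfl⟩
    have : v.valuation K (algebraMap (𝓞 K) K t) ≤ 1 := v.valuation_le_one t
    rwa [ht, map_mul, map_pow, hv1, one_pow, one_mul] at this
  refine le_antisymm (key u hu) ?_
  have h := key _ (U.inv_mem hu)
  rw [Units.val_inv_eq_inv_val, map_inv₀] at h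
  exact (inv_le_one₀ (zero_lt_iff.2 ((Valuation.ne_zero_iff _).2 u.ne_zero))).1 h

end SUnit

/-! ### Endomorphisms of G_A as linear maps and as elements of ℚ[x]/(h_A). -/

namespace ToroidalGroup

open Matrix Polynomial NumberField IsDedekindDomain

variable {n : ℕ} (A : Matrix (Fin n) (Fin n) ℤ)

/-- An integer matrix, acting on rational vectors. -/
noncomputable def ratLin : Matrix (Fin n) (Fin n) ℤ →+* Module.End ℚ (Fin n → ℚ) :=
  (Matrix.toLinAlgEquiv' : Matrix (Fin n) (Fin n) ℚ ≃ₐ[ℚ] _).toRingEquiv.toRingHom.comp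
    (Int.castRingHom ℚ).mapMatrix

theorem ratLin_apply (v : Fin n → ℚ) : ratLin A v = ratMatrix A *ᵥ v := rfl

theorem ratLin_pow_apply (k : ℕ) (v : Fin n → ℚ) : (ratLin A ^ k) v = ratMatrix A ^ k *ᵥ v := by
  induction k with
  | zero => simp
  | succ k ih =>
    rw [pow_succ', Module.End.mul_apply, ih, ratLin_apply, Matrix.mulVec_mulVec, ← pow_succ']

theorem isIntegral_ratLin : IsIntegral ℤ (ratLin A) :=
  (IsIntegral.of_finite ℤ A).map (ratLin (n := n)).toIntAlgHom

theorem charpoly_ratLin :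
    (ratLin A).charpoly = A.charpoly.map (algebraMap ℤ ℚ) :=
  ((ratMatrix A).charpoly_mulVecLin).trans (Matrix.charpoly_map A (Int.castRingHom ℚ))

theorem irreducible_charpoly_ratLin (hirr : Irreducible A.charpoly) :
    Irreducible (ratLin A).charpoly := by
  rw [charpoly_ratLin]
  exact (A.charpoly_monic.irreducible_iff_irreducible_map_fraction_map).1 hirr

theorem pos_of_irreducible (hirr : Irreducible A.charpoly) : 0 < n := by
  rcases Nat.eq_zero_or_pos n with rfl | h
  · refine absurd ?_ hirr.not_isUnit
    rw [Matrix.charpoly, Matrix.det_isEmpty]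
    exact isUnit_one
  · exact h

theorem linear_ext {f g : Module.End ℚ (Fin n → ℚ)}
    (h : ∀ x : Fin n → ℤ, f (ratVec x) = g (ratVec x)) : f = g := by
  refine LinearMap.ext fun v => ?_
  obtain ⟨m, x, hm, hx⟩ := exists_nsmul_eq_ratVec v
  have h1 : m • f v = m • g v := by rw [← map_nsmul, ← map_nsmul, hx, h]
  exact nsmul_right_injective hm h1

variable (hA : A.det ≠ 0)

/-- Endomorphisms of `G_A` extend to linear maps. -/
theorem exists_linear_extension (T : groupG A hA →+ groupG A hA) :
    ∃ f : Module.End ℚ (Fin n → ℚ), ∀ g : groupG A hA, f g = T g := by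
  let f : Module.End ℚ (Fin n → ℚ) := (Pi.basisFun ℚ (Fin n)).constr ℚ fun i =>
    (T ⟨ratVec (Pi.single i 1), ratVec_mem A hA _⟩ : Fin n → ℚ)
  have hf : f.toAddMonoidHom.comp (ratVecHom n) =
      ((groupG A hA).subtype.comp T).comp ((ratVecHom n).codRestrict (groupG A hA)
        fun x => ratVec_mem A hA x) := by
    refine AddMonoidHom.functions_ext _ _ _ fun i z => ?_
    have hz : (Pi.single i z : Fin n → ℤ) = z • Pi.single i 1 := by
      rw [← Pi.single_smul, smul_eq_mul, mul_one]
    rw [hz, map_zsmul, map_zsmul]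
    congr 1
    have : ratVec (Pi.single i 1) = Pi.basisFun ℚ (Fin n) i := by
      ext j
      simp [ratVec, Pi.single_apply]
    change f (ratVec (Pi.single i 1)) = (T ⟨ratVec (Pi.single i 1), _⟩ : Fin n → ℚ)
    conv_lhs => rw [this]
    exact Module.Basis.constr_basis _ _ _ _
  refine ⟨f, fun g => ?_⟩
  -- Agreement on ℤ^n is enough: some nonzero multiple of g is integral, and ℚ^n is torsion-free.
  obtain ⟨m, x, hm, hx⟩ := exists_nsmul_eq_ratVec (g : Fin n → ℚ)
  have h1 : m • f g = m • (T g : Fin n → ℚ) := by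
    rw [← map_nsmul, hx, ← AddSubgroup.coe_nsmul, ← map_nsmul]
    refine (DFunLike.congr_fun hf x).trans ?_
    change ((T _ : groupG A hA) : Fin n → ℚ) = T _
    congr 2
    exact Subtype.ext hx.symm
  exact nsmul_right_injective hm h1

theorem nsmulIndex_groupG_ne_zero (p : ℕ) (hp : p.Prime) : (groupG A hA).nsmulIndex p ≠ 0 := by
  have := Fact.mk hp
  rw [nsmulIndex_groupG]
  exact pow_ne_zero _ hp.ne_zero

theorem linear_mul_comm (hirr : Irreducible A.charpoly)
    (hcop : ∃ p : ℕ, p.Prime ∧ Nat.Coprime n (zeroMult A p)) {S T : Module.End ℚ (Fin n → ℚ)}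
    (hS : ∀ g ∈ groupG A hA, S g ∈ groupG A hA) (hT : ∀ g ∈ groupG A hA, T g ∈ groupG A hA) :
    S * T = T * S := by
  obtain ⟨p, hp, hc⟩ := hcop
  have := Fact.mk hp
  have := Fin.pos_iff_nonempty.1 (pos_of_irreducible A hirr)
  refine mul_comm_of_coprime (irreducible_charpoly_ratLin A hirr)
    (fun g hg => mulVec_mem A hA hg) (nsmulIndex_groupG_ne_zero A hA) hp
    (nsmulIndex_groupG A hA p) ?_ hS hT
  rw [Module.finrank_fin_fun]
  exact (Nat.coprime_self_sub_right (zeroMult_le A p)).2 hc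

theorem end_mul_comm (hirr : Irreducible A.charpoly)
    (hcop : ∃ p : ℕ, p.Prime ∧ Nat.Coprime n (zeroMult A p))
    (S T : AddMonoid.End (groupG A hA)) : S * T = T * S := by
  obtain ⟨f, hf⟩ := exists_linear_extension A hA S
  obtain ⟨f', hf'⟩ := exists_linear_extension A hA T
  have h := linear_mul_comm A hA hirr hcop (S := f) (T := f')
    (fun g hg => by rw [hf ⟨g, hg⟩]; exact Subtype.property _)
    (fun g hg => by rw [hf' ⟨g, hg⟩]; exact Subtype.property _)
  refine AddMonoidHom.ext fun g => Subtype.ext ?_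
  have := LinearMap.congr_fun h g
  rwa [Module.End.mul_apply, Module.End.mul_apply, hf', hf, hf, hf'] at this

/-- A linear map from `ℤ ^ n` to `G_A` becomes integral after multiplication by a power of `A`. -/
theorem exists_pow_mul_eq_ratLin {f : Module.End ℚ (Fin n → ℚ)}
    (hf : ∀ g ∈ groupG A hA, f g ∈ groupG A hA) :
    ∃ (k : ℕ) (B : Matrix (Fin n) (Fin n) ℤ), ratLin A ^ k * f = ratLin B := by
  choose k x hx using fun i : Fin n =>
    (mem_groupG_iff A hA).1 (hf _ (ratVec_mem A hA (Pi.single i 1)))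
  -- A common exponent, at least each `k i`.
  let m := ∑ i, k i
  have hm : ∀ i, ∃ y : Fin n → ℤ, ratMatrix A ^ m *ᵥ f (ratVec (Pi.single i 1)) = ratVec y := by
    intro i
    have hi : k i ≤ m := Finset.single_le_sum (fun _ _ => Nat.zero_le _) (Finset.mem_univ i)
    refine ⟨A ^ (m - k i) *ᵥ x i, ?_⟩
    rw [← ratMatrix_pow_mulVec, ← hx i, Matrix.mulVec_mulVec, ← pow_add, Nat.sub_add_cancel hi]
  choose y hy using hm
  refine ⟨m, Matrix.of fun i j => y j i, (Pi.basisFun ℚ (Fin n)).ext fun i => ?_⟩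
  have hi : Pi.basisFun ℚ (Fin n) i = ratVec (Pi.single i 1) := by
    ext j
    simp [ratVec, Pi.single_apply]
  rw [hi, Module.End.mul_apply, ratLin_pow_apply, hy, ratLin_apply, ratMatrix_mulVec,
    Matrix.mulVec_single_one]
  rfl

/-- The field `ℚ[x] / (h_A)`. -/
abbrev CharField : Type := AdjoinRoot (ratLin A).charpoly

variable [hirr : Fact (Irreducible (ratLin A).charpoly)]

instance numberField_charField : NumberField (CharField A) where
  to_charZero := charZero_of_injective_algebraMap (algebraMap ℚ (CharField A)).injective
  to_finiteDimensional := (AdjoinRoot.powerBasis hirr.out.ne_zero).finite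

/-- The action of `ℚ[x] / (h_A)` on `ℚ ^ n`, with `x` acting as `A`. -/
noncomputable def fieldAct : CharField A →ₐ[ℚ] Module.End ℚ (Fin n → ℚ) :=
  Ideal.Quotient.liftₐ _ (aeval (ratLin A)) fun q hq => by
    obtain ⟨r, rfl⟩ := Ideal.mem_span_singleton.1 hq
    rw [map_mul, LinearMap.aeval_self_charpoly, zero_mul]

theorem fieldAct_mk (q : ℚ[X]) : fieldAct A (AdjoinRoot.mk _ q) = aeval (ratLin A) q := rfl

theorem fieldAct_root : fieldAct A (AdjoinRoot.root _) = ratLin A :=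
  (fieldAct_mk A X).trans (aeval_X _)

theorem fieldAct_injective [Nonempty (Fin n)] : Function.Injective (fieldAct A) :=
  (fieldAct A).toRingHom.injective

theorem exists_fieldAct_eq [Nonempty (Fin n)] {f : Module.End ℚ (Fin n → ℚ)}
    (hf : f * ratLin A = ratLin A * f) : ∃ x, fieldAct A x = f := by
  obtain ⟨q, rfl⟩ := exists_eq_aeval_of_commute hirr.out hf
  exact ⟨_, fieldAct_mk A q⟩

/-- The faithful action sends the root to A, which is integral over ℤ as an integer matrix. -/
theorem isIntegral_root [Nonempty (Fin n)] :
    IsIntegral ℤ (AdjoinRoot.root (ratLin A).charpoly) := by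
  rw [← isIntegral_algHom_iff ((fieldAct A).restrictScalars ℤ) (fieldAct_injective A)]
  change IsIntegral ℤ (fieldAct A (AdjoinRoot.root _))
  rw [fieldAct_root]
  exact isIntegral_ratLin A

theorem root_ne_zero [Nonempty (Fin n)] (hA : A.det ≠ 0) :
    AdjoinRoot.root (ratLin A).charpoly ≠ 0 := by
  intro h
  have h1 := fieldAct_root A
  rw [h, map_zero] at h1
  obtain ⟨v, hv⟩ := exists_ne (0 : Fin n → ℚ)
  apply hv
  apply ratMatrix_pow_mulVec_injective A hA 1
  simp only [← ratLin_pow_apply, ← h1]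
  simp

theorem exists_pow_mul_isIntegral [Nonempty (Fin n)] {x : CharField A}
    (hx : ∀ g ∈ groupG A hA, fieldAct A x g ∈ groupG A hA) :
    ∃ k : ℕ, IsIntegral ℤ (AdjoinRoot.root (ratLin A).charpoly ^ k * x) := by
  obtain ⟨k, B, hB⟩ := exists_pow_mul_eq_ratLin A hA hx
  refine ⟨k, ?_⟩
  rw [← isIntegral_algHom_iff ((fieldAct A).restrictScalars ℤ) (fieldAct_injective A)]
  have : fieldAct A (AdjoinRoot.root (ratLin A).charpoly ^ k * x) = ratLin B := by
    rw [map_mul, map_pow, fieldAct_root, hB]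
  exact this ▸ isIntegral_ratLin B

/-- The units of `ℚ[x] / (h_A)` that stabilize `G_A`. -/
def stabUnits : Subgroup (CharField A)ˣ where
  carrier := {u | (∀ g ∈ groupG A hA, fieldAct A u g ∈ groupG A hA) ∧
    ∀ g ∈ groupG A hA, fieldAct A (u⁻¹ : (CharField A)ˣ) g ∈ groupG A hA}
  one_mem' := by simp
  mul_mem' := by
    rintro u v ⟨hu, hu'⟩ ⟨hv, hv'⟩
    refine ⟨fun g hg => ?_, fun g hg => ?_⟩
    · rw [Units.val_mul, map_mul]
      exact hu _ (hv _ hg)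
    · rw [_root_.mul_inv_rev, Units.val_mul, map_mul]
      exact hv' _ (hu' _ hg)
  inv_mem' := by
    rintro u ⟨hu, hu'⟩
    exact ⟨hu', by rwa [inv_inv]⟩

theorem stabUnits_fg [Nonempty (Fin n)] : Group.FG (stabUnits A hA) :=
  fg_of_isIntegral_pow_mul (root_ne_zero A hA) (isIntegral_root A)
    fun _ hu => exists_pow_mul_isIntegral A hA hu.1

/-- Stabilizing units act by automorphisms. -/
noncomputable def stabUnitsHom : stabUnits A hA →* Multiplicative (AddAut (groupG A hA)) where
  toFun u := Multiplicative.ofAdd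
    { toFun := fun g => ⟨fieldAct A (u : (CharField A)ˣ) g, u.2.1 g g.2⟩
      invFun := fun g => ⟨fieldAct A ((u : (CharField A)ˣ)⁻¹ : (CharField A)ˣ) g, u.2.2 g g.2⟩
      left_inv := fun g => Subtype.ext <| by
        change fieldAct A _ (fieldAct A _ (g : Fin n → ℚ)) = g
        rw [← Module.End.mul_apply, ← map_mul, Units.inv_mul, map_one, Module.End.one_apply]
      right_inv := fun g => Subtype.ext <| by
        change fieldAct A _ (fieldAct A _ (g : Fin n → ℚ)) = g
        rw [← Module.End.mul_apply, ← map_mul, Units.mul_inv, map_one, Module.End.one_apply]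
      map_add' := fun g h => Subtype.ext (map_add _ _ _) }
  map_one' := by
    refine AddEquiv.ext fun g => Subtype.ext ?_
    change fieldAct A 1 g = (g : Fin n → ℚ)
    rw [map_one, Module.End.one_apply]
  map_mul' _ _ := by
    refine AddEquiv.ext fun g => Subtype.ext ?_
    change fieldAct A (_ * _) g = fieldAct A _ (fieldAct A _ g)
    rw [map_mul, Module.End.mul_apply]

theorem exists_fieldAct_extension [Nonempty (Fin n)]
    (hc : ∀ S : Module.End ℚ (Fin n → ℚ), (∀ g ∈ groupG A hA, S g ∈ groupG A hA) →
      S * ratLin A = ratLin A * S) (T : groupG A hA →+ groupG A hA) :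
    ∃ x : CharField A, ∀ g : groupG A hA, fieldAct A x g = T g := by
  obtain ⟨f, hf⟩ := exists_linear_extension A hA T
  obtain ⟨x, rfl⟩ := exists_fieldAct_eq A (hc f fun g hg => by
    rw [hf ⟨g, hg⟩]
    exact Subtype.property _)
  exact ⟨x, hf⟩

theorem stabUnitsHom_surjective [Nonempty (Fin n)]
    (hc : ∀ S : Module.End ℚ (Fin n → ℚ), (∀ g ∈ groupG A hA, S g ∈ groupG A hA) →
      S * ratLin A = ratLin A * S) : Function.Surjective (stabUnitsHom A hA) := by
  intro T
  obtain ⟨x, hx⟩ := exists_fieldAct_extension A hA hc T.toAdd.toAddMonoidHom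
  obtain ⟨y, hy⟩ := exists_fieldAct_extension A hA hc T.toAdd.symm.toAddMonoidHom
  -- The elements x and y represent T and its inverse. Their product acts as the identity on ℤ^n,
  -- hence on ℚ^n, and the action is faithful.
  have hxy : x * y = 1 := by
    apply fieldAct_injective A
    refine linear_ext fun z => ?_
    have h1 := hy ⟨ratVec z, ratVec_mem A hA z⟩
    change fieldAct A y (ratVec z) = _ at h1
    rw [map_mul, map_one, Module.End.mul_apply, Module.End.one_apply, h1, hx]
    exact congrArg Subtype.val (T.toAdd.apply_symm_apply _)
  refine ⟨⟨⟨x, y, hxy, by rw [mul_comm, hxy]⟩, fun g hg => ?_, fun g hg => ?_⟩, ?_⟩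
  · exact hx ⟨g, hg⟩ ▸ Subtype.property _
  · exact hy ⟨g, hg⟩ ▸ Subtype.property _
  · exact AddEquiv.ext fun g => Subtype.ext (hx g)

end ToroidalGroup

theorem mainTheorem2 (n : ℕ) (A : Matrix (Fin n) (Fin n) ℤ) (hA : A.det ≠ 0)
    (hirr : Irreducible A.charpoly)
    (hP' : (ToroidalGroup.primesP' A).Nonempty)
    (hcop : ∃ p : ℕ, p.Prime ∧ Nat.Coprime n (ToroidalGroup.zeroMult A p)) :
    (∀ S T : AddMonoid.End (ToroidalGroup.groupG A hA), S * T = T * S) ∧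
    (∀ S T : Multiplicative (AddAut (ToroidalGroup.groupG A hA)), S * T = T * S) ∧
    Group.FG (Multiplicative (AddAut (ToroidalGroup.groupG A hA))) := by
  have hend := ToroidalGroup.end_mul_comm A hA hirr hcop
  refine ⟨hend, fun S T => AddEquiv.ext fun g => ?_, ?_⟩
  · exact DFunLike.congr_fun (hend S.toAdd.toAddMonoidHom T.toAdd.toAddMonoidHom) g
  · have := Fact.mk (ToroidalGroup.irreducible_charpoly_ratLin A hirr)
    have := Fin.pos_iff_nonempty.1 (ToroidalGroup.pos_of_irreducible A hirr)
    have := ToroidalGroup.stabUnits_fg A hA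
    -- A itself preserves G_A, so every linear map preserving G_A commutes with A and comes from the
    -- field.
    exact Group.fg_of_surjective (ToroidalGroup.stabUnitsHom_surjective A hA fun S hS =>
      ToroidalGroup.linear_mul_comm A hA hirr hcop hS fun g hg => ToroidalGroup.mulVec_mem A hA hg)
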